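/- Let $k\ge 2$ and $b\ge 2$ be integers, and let $\Psi:\{1,2,3,\ldots\}\to\mathbb{R}_{>0}$ satisfy $\Psi(x)<\frac{1}{2x}$ for all sufficiently large integers $x$. Let $K$ be the set of real numbers in $[0,1]$ that have a base-$b$ expansion $\sum_{i\ge 1} d_i b^{-i}$ with all digits $d_i\in\{0,1\}$. For a function $\Phi:\{1,2,3,\ldots\}\to\mathbb{R}$ let $\mathcal{K}_k(\Phi)$ be the set of all real numbers $\zeta$, not algebraic of degree $\le k$ over $\mathbb{Q}$, such that $$\max_{1\le j\le k}|\zeta^{j}q-p_{j}|\le \Phi(q)$$ holds for infinitely many integer vectors $(q,p_1,\ldots,p_k)$ with $q\ge 1$, and let $\mathcal{K}_k^{*}(\Phi)$ be defined in the same way, counting only vectors with $\gcd(q,p_1,\ldots,p_k)=1$. (i) If in addition $\Psi(lx)\le l\,\Psi(x)$ for all integers $l,x\ge 1$, then for every real $c<1/b$ the set $\bigl(\mathcal{K}_k(\Psi)\setminus\mathcal{K}_k(c\Psi)\bigr)\cap K$ is uncountable. (ii) For every real $c<1/b$ the set $\bigl(\mathcal{K}_k^{*}(\Psi)\setminus\mathcal{K}_k^{*}(c\Psi)\bigr)\cap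 K$ is uncountable (without the additional condition in (i)). -/

import Mathlib

namespace PowerApprox

/-- The real numbers that are not algebraic (over the rationals) of degree at most `k`. -/
def notAlgDegLE (k : ℕ) : Set ℝ :=
  {ζ | ¬ (IsAlgebraic ℚ ζ ∧ (minpoly ℚ ζ).natDegree ≤ k)}

/-- The vector `(q, p₁, …, p_k)` satisfies `q ≥ 1` and `|ζ ^ j * q - p_j| ≤ Ψ q` for every
`j = 1, …, k`. The coordinate `p_j` is stored at the index `j - 1` of `Fin k`. -/
def IsSolution (k : ℕ) (Ψ : ℕ → ℝ) (ζ : ℝ) (v : ℕ × (Fin k → ℤ)) : Prop :=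
  1 ≤ v.1 ∧ ∀ j : Fin k, |ζ ^ ((j : ℕ) + 1) * (v.1 : ℝ) - (v.2 j : ℝ)| ≤ Ψ v.1

/-- The vector `(q, p₁, …, p_k)` is relatively prime: its entries have no common divisor
besides `1`. -/
def IsPrimitive {k : ℕ} (v : ℕ × (Fin k → ℤ)) : Prop :=
  ∀ d : ℕ, d ∣ v.1 → (∀ j : Fin k, (d : ℤ) ∣ v.2 j) → d = 1

/-- The set `𝒦_k(Ψ)`: real numbers, not algebraic of degree at most `k`, whose first `k` powers
are simultaneously approximated to order `Ψ` by infinitely many integer vectors. -/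
def approxSet (k : ℕ) (Ψ : ℕ → ℝ) : Set ℝ :=
  {ζ | ζ ∈ notAlgDegLE k ∧ {v : ℕ × (Fin k → ℤ) | IsSolution k Ψ ζ v}.Infinite}

/-- The set `𝒦_k*(Ψ)`: as `𝒦_k(Ψ)`, with only relatively prime integer vectors counted. -/
def approxSetStar (k : ℕ) (Ψ : ℕ → ℝ) : Set ℝ :=
  {ζ | ζ ∈ notAlgDegLE k ∧
    {v : ℕ × (Fin k → ℤ) | IsSolution k Ψ ζ v ∧ IsPrimitive v}.Infinite}

/-- The real numbers `∑ d_i * b ^ (-i)` (over `i ≥ 1`) all of whose base `b` digits `d_i`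
lie in `J`. -/
def digitSet (b : ℕ) (J : Set ℕ) : Set ℝ :=
  {x | ∃ d : ℕ → Fin b, (∀ i, (d i : ℕ) ∈ J) ∧ x = Real.ofDigits d}

end PowerApprox

/-! Take `ζ = ∑ b ^ (-a n)`, at most `1 / 4`, with exponents growing at least fourfold. If all
errors `ζ ^ j * q - p_j` are below `1 / (2 q)`, integrality forces `p_j / q = x ^ j` for a rational
`x`, so `x.den ^ k` divides `q` (`IsSolution.exists_rat`). Since `k ≥ 2`, `x.den ^ 2 ≤ q`, and for
large `q` the bound `|ζ - x| < 1 / (2 q ^ 2)` leaves only the partial sums `r n` for `x`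
(`exists_eq_of_abs_sub_lt`). So the order of approximation is read off from the vectors with `q = b
^ (k * a n)`; their multiples are excluded by primitivity, or controlled by `Ψ (l * x) ≤ l * Ψ x`.

The error `ζ - r n` is `b ^ (-a (n + 1))` plus a far smaller tail. Choosing `a (n + 1)` as the least
exponent compatible with `Ψ` (`exists_step`) gives a solution for `Ψ`, while minimality rules out `c
* Ψ` for `c < 1 / b` and large `n`. Lowering the exponent by one only enlarges the error, so this
free bit at every second step does no harm and yields uncountably many `ζ`. The algebraic ones among
them are countable and are simply discarded. -/

namespace PowerApprox

/-! ### Rigidity of very good approximations -/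

/-- If `ζ` is small and all of `ζ ^ j * q - p_j` are smaller than `1 / (2 q)`, then
`p_j / q = (p_1 / q) ^ j`. -/
lemma eq_pow_mul_of_abs_sub_lt {k : ℕ} (hk : 0 < k) {ζ : ℝ} (h0 : 0 ≤ ζ) (h1 : ζ ≤ 1 / 4)
    {q : ℕ} (hq : 2 ≤ q) {p : Fin k → ℤ}
    (hp : ∀ j : Fin k, |ζ ^ ((j : ℕ) + 1) * (q : ℝ) - (p j : ℝ)| < 1 / 2 * (q : ℝ)⁻¹) (i : ℕ) (hi : i < k) :
    (p ⟨i, hi⟩ : ℝ) = ((p ⟨0, hk⟩ : ℝ) / q) ^ (i + 1) * q := by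
  have hq' : (2 : ℝ) ≤ q := by exact_mod_cast hq
  have hq0 : (0 : ℝ) < q := by linarith
  induction i with
  | zero => rw [zero_add, pow_one, div_mul_cancel₀ _ hq0.ne']
  | succ i ih =>
    set ε : ℝ := 1 / 2 * (q : ℝ)⁻¹ with hε
    have hi' : i < k := by omega
    specialize ih hi'
    have e0 := hp ⟨0, hk⟩
    have e1 := hp ⟨i, hi'⟩
    have e2 := hp ⟨i + 1, hi⟩
    set x : ℝ := (p ⟨0, hk⟩ : ℝ) with hx
    set y : ℝ := (p ⟨i, hi'⟩ : ℝ) with hy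
    set z : ℝ := (p ⟨i + 1, hi⟩ : ℝ) with hz
    simp only [zero_add, pow_one] at e0 e1 e2
    have hεq : ε * q = 1 / 2 := by rw [hε]; field_simp
    have hε0 : 0 < ε := (abs_nonneg _).trans_lt e0
    have hε4 : ε ≤ 1 / 4 := by nlinarith
    have hpow : ζ ^ (i + 1) ≤ 1 / 4 := by
      rw [pow_succ]
      have : ζ ^ i ≤ 1 := pow_le_one₀ h0 (by linarith)
      nlinarith
    have hpow0 : 0 ≤ ζ ^ (i + 1) := by positivity
    -- The determinant `x * y - q * z` is an integer; the bounds below give at most `(1/4 + 1/4 + 1)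
    -- * ε * q + 1/16 = 13/16`, so it vanishes.
    have key : x * y - q * z = q * (-ζ * (ζ ^ (i + 1) * q - y) - ζ ^ (i + 1) * (ζ * q - x)
        + (ζ ^ (i + 1 + 1) * q - z)) + (ζ * q - x) * (ζ ^ (i + 1) * q - y) := by ring
    have hlt : |x * y - q * z| < 1 := by
      rw [key]
      have t1 : |ζ * (ζ ^ (i + 1) * q - y)| ≤ 1 / 4 * ε := by
        rw [abs_mul, abs_of_nonneg h0]; gcongr
      have t2 : |ζ ^ (i + 1) * (ζ * q - x)| ≤ 1 / 4 * ε := by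
        rw [abs_mul, abs_of_nonneg hpow0]; gcongr
      have t3 : |(ζ * q - x) * (ζ ^ (i + 1) * q - y)| ≤ 1 / 4 * (1 / 4) := by
        rw [abs_mul]; gcongr <;> linarith
      rw [abs_le] at t1 t2 t3
      rw [abs_lt] at e2 ⊢
      constructor <;> nlinarith
    have hz0 : p ⟨0, hk⟩ * p ⟨i, hi'⟩ - q * p ⟨i + 1, hi⟩ = 0 := by
      rw [← Int.abs_lt_one_iff]
      rw [hx, hy, hz] at hlt
      exact_mod_cast hlt
    have hz1 : x * y - q * z = 0 := by rw [hx, hy, hz]; exact_mod_cast hz0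
    have : z = x / q * y := by field_simp; linarith
    rw [this, ih]; ring

/-- Distinct rational numbers are separated by the inverse product of their denominators. -/
lemma inv_den_mul_den_le_abs_sub {x y : ℚ} (h : x ≠ y) :
    ((x.den : ℝ) * y.den)⁻¹ ≤ |(x : ℝ) - y| := by
  have hx : (0 : ℝ) < x.den := by exact_mod_cast x.den_pos
  have hy : (0 : ℝ) < y.den := by exact_mod_cast y.den_pos
  have e : (x : ℝ) - y = ((x.num * y.den - y.num * x.den : ℤ) : ℝ) / (x.den * y.den) := by
    rw [Rat.cast_def x, Rat.cast_def y]; push_cast; field_simp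
  have hne : x.num * y.den - y.num * x.den ≠ 0 := by
    intro h0
    exact h (Rat.eq_iff_mul_eq_mul.2 (by linarith))
  rw [e, abs_div, abs_of_pos (mul_pos hx hy), inv_eq_one_div]
  gcongr
  exact_mod_cast Int.one_le_abs hne

/-- If `ζ` is approximated by a sequence of rational numbers with rapidly increasing
denominators, then all its very good rational approximations belong to the sequence. -/
lemma exists_eq_of_abs_sub_lt {ζ : ℝ} {r : ℕ → ℚ} (h3 : 3 ≤ (r 0).den)
    (hgrow : ∀ n, 4 * (r n).den ^ 2 ≤ (r (n + 1)).den)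
    (hr : ∀ n, |ζ - r n| ≤ 2 / ((r (n + 1)).den : ℝ))
    {x : ℚ} {q : ℕ} (hxq : x.den ^ 2 ≤ q) (hq : (r 0).den ≤ q)
    (hx : |ζ - x| < 1 / 2 * ((q : ℝ)⁻¹) ^ 2) : ∃ n, x = r n := by
  by_contra! hne
  have hqpos : (0 : ℝ) < q := by exact_mod_cast (by omega : 0 < q)
  have hd : (0 : ℝ) < x.den := by exact_mod_cast x.den_pos
  have hD : ∀ n, (0 : ℝ) < (r n).den := fun n ↦ by exact_mod_cast (r n).den_pos
  have hsep : ∀ n, ((x.den : ℝ) * (r n).den)⁻¹ <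
      1 / 2 * ((q : ℝ)⁻¹) ^ 2 + 2 / ((r (n + 1)).den : ℝ) := fun n ↦ by
    have h1 := inv_den_mul_den_le_abs_sub (hne n)
    have h2 : |(x : ℝ) - r n| ≤ |ζ - x| + |ζ - r n| := by
      rw [abs_sub_comm ζ x]; exact abs_sub_le _ _ _
    linarith [hr n]
  -- When `x.den < (r n).den`, the term `2 / (r (n + 1)).den` is at most half the separation,
  -- leaving `q ^ 2 < x.den * (r n).den`.
  have hnext : ∀ n, x.den < (r n).den → q ^ 2 < x.den * (r n).den := fun n hn ↦ by
    have h1 := hsep n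
    have hn' : (x.den : ℝ) ≤ (r n).den := by exact_mod_cast hn.le
    have h2 : 2 / ((r (n + 1)).den : ℝ) ≤ 1 / 2 * ((x.den : ℝ) * (r n).den)⁻¹ := by
      have h4 : (4 : ℝ) * (r n).den ^ 2 ≤ (r (n + 1)).den := by exact_mod_cast hgrow n
      calc 2 / ((r (n + 1)).den : ℝ) ≤ 2 / (4 * (x.den * (r n).den)) := by
            have := mul_pos hd (hD n)
            gcongr
            nlinarith [hD n]
        _ = _ := by field_simp; norm_num
    have h5 : ((x.den : ℝ) * (r n).den)⁻¹ < ((q : ℝ) ^ 2)⁻¹ := by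
      rw [inv_pow] at h1; linarith
    have h6 := (inv_lt_inv₀ (mul_pos hd (hD n)) (by positivity)).1 h5
    exact_mod_cast h6
  have hex : ∃ n, x.den < (r n).den := by
    have hmono : StrictMono fun n ↦ (r n).den := strictMono_nat_of_lt_succ fun n ↦ by
      have := hgrow n
      have := (r n).den_pos
      nlinarith
    exact ⟨x.den + 1, (Nat.lt_succ_self _).trans_le (hmono.id_le _)⟩
  classical
  have hn := Nat.find_spec hex
  have hmin := fun m ↦ Nat.find_min (m := m) hex
  generalize Nat.find hex = n at hn hmin
  have hqn := hnext n hn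
  -- Here `n` is the least index with `x.den < (r n).den`. For `n = 0` the size of `q` contradicts
  -- `hqn`. For `n = m + 1`, write `d = x.den`: then `d ^ 3 ≤ (r (m + 1)).den`, and separation from
  -- `r m` gives `1 / d ^ 2 < 1 / (2 * d ^ 4) + 2 / d ^ 3`, impossible for `d ≥ 3`.
  cases n with
  | zero => nlinarith
  | succ m =>
    have hm : (r m).den ≤ x.den := not_lt.1 (hmin m (Nat.lt_succ_self m))
    have h0m : 3 ≤ (r m).den := by
      have hmono : StrictMono fun n ↦ (r n).den := strictMono_nat_of_lt_succ fun n ↦ by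
        have := hgrow n
        have := (r n).den_pos
        nlinarith
      exact h3.trans (hmono.monotone (Nat.zero_le m))
    have hd3 : (3 : ℝ) ≤ x.den := by exact_mod_cast h0m.trans hm
    have hcube : x.den ^ 3 ≤ (r (m + 1)).den := by
      have h4 : x.den * x.den ^ 3 < x.den * (r (m + 1)).den := by
        calc x.den * x.den ^ 3 = (x.den ^ 2) ^ 2 := by ring
          _ ≤ q ^ 2 := by gcongr
          _ < _ := hqn
      exact (lt_of_mul_lt_mul_left h4 (Nat.zero_le _)).le
    have h1 := hsep m
    have h2 : (1 / (x.den : ℝ)) ^ 2 ≤ ((x.den : ℝ) * (r m).den)⁻¹ := by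
      rw [one_div, inv_pow, sq]
      have := hD m
      gcongr
    have h3' : ((q : ℝ)⁻¹) ^ 2 ≤ (1 / (x.den : ℝ)) ^ 4 := by
      rw [inv_pow, one_div, inv_pow]
      have : (x.den : ℝ) ^ 2 ≤ q := by exact_mod_cast hxq
      gcongr
      calc (x.den : ℝ) ^ 4 = (x.den ^ 2) ^ 2 := by ring
        _ ≤ _ := by gcongr
    have h4 : 2 / ((r (m + 1)).den : ℝ) ≤ 2 * (1 / (x.den : ℝ)) ^ 3 := by
      have : (x.den : ℝ) ^ 3 ≤ (r (m + 1)).den := by exact_mod_cast hcube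
      rw [one_div, inv_pow, div_eq_mul_inv]
      gcongr
    have hu : 1 / (x.den : ℝ) ≤ 1 / 3 := by gcongr
    have hu0 : 0 < 1 / (x.den : ℝ) := by positivity
    generalize 1 / (x.den : ℝ) = u at *
    have h5 : u ^ 3 ≤ 1 / 3 * u ^ 2 := by nlinarith [sq_nonneg u]
    have h6 : u ^ 4 ≤ 1 / 9 * u ^ 2 := by nlinarith [sq_nonneg u]
    nlinarith [sq_nonneg u]

/-! ### Lacunary series and their digits -/

section Series

variable {β : ℝ} {a : ℕ → ℕ}

lemma summable_pow_strictMono (h0 : 0 < β) (h1 : β ≤ 1 / 2) (ha : StrictMono a) :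
    Summable fun n ↦ β ^ a n :=
  Summable.of_nonneg_of_le (fun _ ↦ by positivity)
    (fun n ↦ pow_le_pow_of_le_one h0.le (by linarith) (ha.id_le n))
    (summable_geometric_of_lt_one h0.le (by linarith))

lemma strictMono_comp_add (ha : StrictMono a) (n : ℕ) : StrictMono fun m ↦ a (m + n) :=
  fun _ _ h ↦ ha (by omega)

lemma tsum_pow_eq_add (h0 : 0 < β) (h1 : β ≤ 1 / 2) (ha : StrictMono a) (n : ℕ) :
    ∑' m, β ^ a (m + n) = β ^ a n + ∑' m, β ^ a (m + (n + 1)) := by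
  rw [(summable_pow_strictMono h0 h1 (strictMono_comp_add ha n)).tsum_eq_zero_add, zero_add]
  simp only [add_assoc, add_comm 1 n]

lemma tsum_pow_le (h0 : 0 < β) (h1 : β ≤ 1 / 2) (ha : StrictMono a) (n : ℕ) :
    ∑' m, β ^ a (m + n) ≤ 2 * β ^ a n := by
  have hg := summable_geometric_of_lt_one h0.le (by linarith : β < 1)
  calc ∑' m, β ^ a (m + n) ≤ ∑' m, β ^ m * β ^ a n := by
        refine Summable.tsum_le_tsum (fun m ↦ ?_)
          (summable_pow_strictMono h0 h1 (strictMono_comp_add ha n)) (hg.mul_right _)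
        rw [← pow_add]
        exact pow_le_pow_of_le_one h0.le (by linarith) (ha.add_le_nat m n)
    _ = (1 - β)⁻¹ * β ^ a n := by
        rw [tsum_mul_right, tsum_geometric_of_lt_one h0.le (by linarith)]
    _ ≤ 2 * β ^ a n := by
        gcongr
        rw [inv_le_comm₀ (by linarith) (by norm_num)]
        linarith

lemma tsum_pow_pos (h0 : 0 < β) (h1 : β ≤ 1 / 2) (ha : StrictMono a) (n : ℕ) :
    0 < ∑' m, β ^ a (m + n) :=
  (summable_pow_strictMono h0 h1 (strictMono_comp_add ha n)).tsum_pos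
    (fun _ ↦ by positivity) 0 (by positivity)

/-- The first differing exponent decides: the delayed tail is at most `2 * β ^ (a n + 1) ≤ β ^ a n`,
and the other series has a positive remainder beyond `β ^ a n`. That remainder gives strictness even
for `β = 1 / 2`. -/
lemma tsum_pow_lt_tsum_pow (h0 : 0 < β) (h1 : β ≤ 1 / 2) {a' : ℕ → ℕ} (ha : StrictMono a)
    (ha' : StrictMono a') {n : ℕ} (heq : ∀ i < n, a i = a' i) (hlt : a n < a' n) :
    ∑' m, β ^ a' m < ∑' m, β ^ a m := by
  rw [← (summable_pow_strictMono h0 h1 ha).sum_add_tsum_nat_add n,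
    ← (summable_pow_strictMono h0 h1 ha').sum_add_tsum_nat_add n,
    Finset.sum_congr rfl fun i hi ↦ congrArg (β ^ ·) (heq i (Finset.mem_range.1 hi)).symm,
    add_lt_add_iff_left]
  have h2 := tsum_pow_pos h0 h1 ha (n + 1)
  rw [tsum_pow_eq_add h0 h1 ha n]
  have h3 := tsum_pow_le h0 h1 ha' n
  have h4 : β ^ a' n ≤ β ^ (a n + 1) := pow_le_pow_of_le_one h0.le (by linarith) hlt
  have h5 : 0 < β ^ a n := by positivity
  rw [pow_succ] at h4
  nlinarith

lemma eq_of_tsum_pow_eq (h0 : 0 < β) (h1 : β ≤ 1 / 2) {a' : ℕ → ℕ} (ha : StrictMono a)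
    (ha' : StrictMono a') (h : ∑' m, β ^ a m = ∑' m, β ^ a' m) : a = a' := by
  funext n
  induction n using Nat.strong_induction_on with
  | _ n ih =>
    rcases lt_trichotomy (a n) (a' n) with hlt | heq | hlt
    · exact absurd h.symm (tsum_pow_lt_tsum_pow h0 h1 ha ha' ih hlt).ne
    · exact heq
    · exact absurd h (tsum_pow_lt_tsum_pow h0 h1 ha' ha (fun i hi ↦ (ih i hi).symm) hlt).ne

end Series

lemma tsum_pow_mem_digitSet {b : ℕ} (hb : 2 ≤ b) {a : ℕ → ℕ} (ha : StrictMono a)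
    (ha0 : 0 < a 0) : ∑' n, ((b : ℝ)⁻¹) ^ a n ∈ digitSet b {0, 1} := by
  classical
  have hpos : ∀ n, 0 < a n := fun n ↦ ha0.trans_le (ha.monotone (Nat.zero_le n))
  -- The digit with index `i` has weight `b ^ (-(i + 1))`, hence the shift by one.
  refine ⟨fun i ↦ if i + 1 ∈ Set.range a then ⟨1, by omega⟩ else ⟨0, by omega⟩,
    fun i ↦ by dsimp only; split_ifs <;> simp, ?_⟩
  have hinj : Function.Injective fun n ↦ a n - 1 := fun m n h ↦ ha.injective <| by
    have := hpos m
    have := hpos n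
    simp only at h
    omega
  rw [Real.ofDigits, ← hinj.tsum_eq (f := Real.ofDigitsTerm _)]
  · refine tsum_congr fun n ↦ ?_
    have : a n - 1 + 1 = a n := Nat.sub_add_cancel (hpos n)
    simp only [Real.ofDigitsTerm, this, Set.mem_range_self, if_true]
    simp
  · intro i hi
    by_contra hni
    apply hi
    have : i + 1 ∉ Set.range a := by
      rintro ⟨n, hn⟩
      exact hni ⟨n, by simp [hn]⟩
    simp only [Real.ofDigitsTerm, if_neg this]
    simp

/-- The numerator of the `n`-th partial sum of `∑ b ^ (-a n)`. -/
def partialNum (b : ℕ) (a : ℕ → ℕ) : ℕ → ℕ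
  | 0 => 1
  | n + 1 => partialNum b a n * b ^ (a (n + 1) - a n) + 1

/-- The numerator is `1` modulo `b` after the first step, so the partial sums are in lowest terms
with denominator exactly `b ^ a n`. -/
lemma partialNum_coprime {b : ℕ} {a : ℕ → ℕ} (ha : StrictMono a) (n : ℕ) :
    (partialNum b a n).Coprime b := by
  cases n with
  | zero => exact Nat.coprime_one_left b
  | succ n =>
    obtain ⟨t, ht⟩ : b ∣ partialNum b a n * b ^ (a (n + 1) - a n) :=
      Dvd.dvd.mul_left (dvd_pow_self b (Nat.sub_pos_of_lt (ha n.lt_succ_self)).ne') _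
    rw [partialNum, ht]
    simp

lemma partialNum_div {b : ℕ} (hb : 0 < b) {a : ℕ → ℕ} (ha : StrictMono a) (n : ℕ) :
    (partialNum b a n : ℝ) / (b : ℝ) ^ a n =
      ∑ i ∈ Finset.range (n + 1), ((b : ℝ)⁻¹) ^ a i := by
  have hb' : (b : ℝ) ≠ 0 := by exact_mod_cast hb.ne'
  induction n with
  | zero => simp [partialNum]
  | succ n ih =>
    rw [Finset.sum_range_succ, ← ih, partialNum]
    have : (b : ℝ) ^ a (n + 1) = b ^ (a (n + 1) - a n) * b ^ a n := by
      rw [← pow_add, Nat.sub_add_cancel (ha n.lt_succ_self).le]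
    push_cast
    rw [inv_pow, this]
    field_simp

/-! ### From simultaneous to rational approximation and back -/

/-- Powers do not expand distances on `[0, 1/4]`, so the coordinate `j = 1` controls all the others.
-/
lemma abs_pow_sub_pow_le {x y : ℝ} (hx0 : 0 ≤ x) (hx : x ≤ 1 / 4) (hy0 : 0 ≤ y) (hy : y ≤ 1 / 4)
    (j : ℕ) : |x ^ (j + 1) - y ^ (j + 1)| ≤ |x - y| := by
  induction j with
  | zero => simp
  | succ j ih =>
    have e : x ^ (j + 1 + 1) - y ^ (j + 1 + 1) =
        x * (x ^ (j + 1) - y ^ (j + 1)) + y ^ (j + 1) * (x - y) := by ring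
    have hyj : y ^ (j + 1) ≤ 1 / 4 := by
      rw [pow_succ]
      have : y ^ j ≤ 1 := pow_le_one₀ hy0 (by linarith)
      nlinarith
    rw [e]
    calc _ ≤ |x| * |x ^ (j + 1) - y ^ (j + 1)| + |y ^ (j + 1)| * |x - y| := by
          rw [← abs_mul, ← abs_mul]; exact abs_add_le _ _
      _ ≤ 1 / 4 * |x - y| + 1 / 4 * |x - y| := by
          rw [abs_of_nonneg hx0, abs_of_nonneg (pow_nonneg hy0 _)]
          gcongr
      _ ≤ |x - y| := by linarith [abs_nonneg (x - y)]

/-- A very good simultaneous approximation to the powers of a small number comes from a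
rational approximation to that number. -/
lemma IsSolution.exists_rat {k : ℕ} (hk : 0 < k) {Φ : ℕ → ℝ} {ζ : ℝ} (h0 : 0 ≤ ζ)
    (h1 : ζ ≤ 1 / 4) {v : ℕ × (Fin k → ℤ)} (hv : IsSolution k Φ ζ v) (hq : 2 ≤ v.1)
    (hΦ : Φ v.1 < 1 / 2 * (v.1 : ℝ)⁻¹) :
    ∃ x : ℚ, x.den ^ k ∣ v.1 ∧ (∀ j : Fin k, (v.2 j : ℚ) = x ^ ((j : ℕ) + 1) * v.1) ∧
      |ζ - x| * v.1 ≤ Φ v.1 ∧ |ζ - x| < 1 / 2 * ((v.1 : ℝ)⁻¹) ^ 2 := by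
  have hpow := eq_pow_mul_of_abs_sub_lt hk h0 h1 hq fun j ↦ (hv.2 j).trans_lt hΦ
  obtain ⟨q, p⟩ := v
  simp only at hq hΦ hpow ⊢
  have hq0 : (0 : ℝ) < q := by exact_mod_cast (by omega : 0 < q)
  have hq0' : (q : ℚ) ≠ 0 := by exact_mod_cast (by omega : q ≠ 0)
  set x : ℚ := (p ⟨0, hk⟩ : ℚ) / q with hx
  have hpx : ∀ j : Fin k, (p j : ℚ) = x ^ ((j : ℕ) + 1) * q := fun j ↦ by
    have := hpow j j.2
    rw [hx]
    exact_mod_cast this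
  have hxζ : |ζ - x| * q ≤ Φ q := by
    have h := hv.2 ⟨0, hk⟩
    simp only [zero_add, pow_one] at h
    have e : ζ * q - p ⟨0, hk⟩ = (ζ - x) * q := by
      rw [hx]; push_cast; field_simp
    rwa [e, abs_mul, abs_of_pos hq0] at h
  refine ⟨x, ?_, hpx, hxζ, ?_⟩
  · have h := hpx ⟨k - 1, by omega⟩
    simp only [Nat.sub_add_cancel hk] at h
    have h2 : x ^ k = Rat.divInt (p ⟨k - 1, by omega⟩) q := by
      rw [Rat.divInt_eq_div, h]; push_cast; field_simp
    have h3 := Rat.den_dvd (p ⟨k - 1, by omega⟩) q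
    rw [← h2, Rat.den_pow] at h3
    exact_mod_cast h3
  · have h := hxζ.trans_lt hΦ
    calc |ζ - x| = |ζ - x| * q * (q : ℝ)⁻¹ := by field_simp
      _ < 1 / 2 * (q : ℝ)⁻¹ * (q : ℝ)⁻¹ := by gcongr
      _ = _ := by ring

/-- The relatively prime integer vector proportional to `(1, x, …, x ^ k)`. -/
def powerVector (k : ℕ) (x : ℚ) : ℕ × (Fin k → ℤ) :=
  (x.den ^ k, fun j ↦ x.num ^ ((j : ℕ) + 1) * (x.den : ℤ) ^ (k - ((j : ℕ) + 1)))

lemma powerVector_snd {k : ℕ} (x : ℚ) (j : Fin k) :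
    ((powerVector k x).2 j : ℚ) = x ^ ((j : ℕ) + 1) * (x.den : ℚ) ^ k := by
  have hj : (j : ℕ) + 1 ≤ k := j.2
  have hs : (x.den : ℚ) ^ k = x.den ^ (k - ((j : ℕ) + 1)) * x.den ^ ((j : ℕ) + 1) := by
    rw [← pow_add, Nat.sub_add_cancel hj]
  simp only [powerVector]
  push_cast
  rw [hs, mul_comm ((x.den : ℚ) ^ _), ← mul_assoc, ← mul_pow, Rat.mul_den_eq_num]

/-- The entries `x.den ^ k` and `x.num ^ k` are already coprime. -/
lemma isPrimitive_powerVector {k : ℕ} (hk : 0 < k) (x : ℚ) : IsPrimitive (powerVector k x) := by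
  intro d h1 h2
  have h3 := h2 ⟨k - 1, by omega⟩
  simp only [powerVector, Nat.sub_add_cancel hk, Nat.sub_self, pow_zero, mul_one] at h1 h3
  rw [Int.natCast_dvd, Int.natAbs_pow] at h3
  exact Nat.eq_one_of_dvd_coprimes (Nat.Coprime.pow k k x.reduced) h3 h1

lemma isSolution_powerVector {k : ℕ} {Φ : ℕ → ℝ} {ζ : ℝ} {x : ℚ}
    (h0 : 0 ≤ ζ) (h1 : ζ ≤ 1 / 4) (hx0 : 0 ≤ (x : ℝ)) (hx1 : (x : ℝ) ≤ 1 / 4)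
    (h : |ζ - x| * ((x.den ^ k : ℕ) : ℝ) ≤ Φ (x.den ^ k)) :
    IsSolution k Φ ζ (powerVector k x) := by
  refine ⟨Nat.one_le_pow _ _ x.den_pos, fun j ↦ ?_⟩
  have e : ((powerVector k x).2 j : ℝ) = (x : ℝ) ^ ((j : ℕ) + 1) * ((x.den ^ k : ℕ) : ℝ) := by
    exact_mod_cast powerVector_snd x j
  rw [e]
  simp only [powerVector]
  rw [← sub_mul, abs_mul, Nat.abs_cast]
  exact (mul_le_mul_of_nonneg_right (abs_pow_sub_pow_le h0 h1 hx0 hx1 j)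
    (Nat.cast_nonneg _)).trans h

lemma IsPrimitive.fst_eq {k : ℕ} {v : ℕ × (Fin k → ℤ)} (hv : IsPrimitive v) {x : ℚ}
    (hd : x.den ^ k ∣ v.1) (hx : ∀ j : Fin k, (v.2 j : ℚ) = x ^ ((j : ℕ) + 1) * v.1) :
    v.1 = x.den ^ k := by
  obtain ⟨m, hm⟩ := hd
  have : m = 1 := hv m (hm ▸ Dvd.intro_left _ rfl) fun j ↦ by
    refine ⟨(powerVector k x).2 j, ?_⟩
    have : (v.2 j : ℚ) = m * (powerVector k x).2 j := by
      rw [hx, powerVector_snd, hm]; push_cast; ring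
    exact_mod_cast this
  rw [hm, this, mul_one]

lemma finite_of_isSolution_of_le {k : ℕ} {Φ : ℕ → ℝ} {ζ : ℝ} {S : Set (ℕ × (Fin k → ℤ))}
    (hS : ∀ v ∈ S, IsSolution k Φ ζ v) (B : ℕ) (hB : ∀ v ∈ S, v.1 ≤ B) : S.Finite := by
  have hfin : ∀ q : ℕ, {p : Fin k → ℤ | IsSolution k Φ ζ (q, p)}.Finite := fun q ↦ by
    refine (Set.Finite.pi' fun j : Fin k ↦ Set.finite_Icc
      ⌈ζ ^ ((j : ℕ) + 1) * (q : ℝ) - Φ q⌉ ⌊ζ ^ ((j : ℕ) + 1) * (q : ℝ) + Φ q⌋).subset ?_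
    intro p hp j
    have := abs_le.1 (hp.2 j)
    simp only at this
    exact ⟨Int.ceil_le.2 (by linarith [this.1, this.2]),
      Int.le_floor.2 (by linarith [this.1, this.2])⟩
  refine ((Set.finite_Iic B).biUnion fun q _ ↦ (hfin q).image (Prod.mk q)).subset fun v hv ↦ ?_
  simp only [Set.mem_iUnion]
  exact ⟨v.1, hB v hv, v.2, hS v hv, rfl⟩

/-! ### Counting solutions through the partial sums -/

section Exact

variable {k : ℕ} {Ψ : ℕ → ℝ} {ζ : ℝ} {r : ℕ → ℚ}

lemma infinite_primitive_solutions (hk : 0 < k) (h0 : 0 ≤ ζ) (h1 : ζ ≤ 1 / 4)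
    (hr0 : ∀ n, 0 ≤ (r n : ℝ)) (hr1 : ∀ n, (r n : ℝ) ≤ 1 / 4)
    (hmono : StrictMono fun n ↦ (r n).den)
    (hgood : ∀ N, ∃ n ≥ N, |ζ - r n| * (((r n).den ^ k : ℕ) : ℝ) ≤ Ψ ((r n).den ^ k)) :
    {v : ℕ × (Fin k → ℤ) | IsSolution k Ψ ζ v ∧ IsPrimitive v}.Infinite := by
  have hI : {n | |ζ - r n| * (((r n).den ^ k : ℕ) : ℝ) ≤ Ψ ((r n).den ^ k)}.Infinite :=
    Set.infinite_of_not_bddAbove fun ⟨B, hB⟩ ↦ by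
      obtain ⟨n, hn, h⟩ := hgood (B + 1)
      have := hB h
      omega
  have hinj : Function.Injective fun n ↦ powerVector k (r n) := fun m n h ↦
    hmono.injective (Nat.pow_left_injective hk.ne' (congrArg Prod.fst h))
  refine (hI.image hinj.injOn).mono ?_
  rintro _ ⟨n, hn, rfl⟩
  exact ⟨isSolution_powerVector h0 h1 (hr0 n) (hr1 n) hn, isPrimitive_powerVector hk _⟩

/-- `hred` is the only place where the two halves of the theorem differ: it passes from a multiple
to the reduced vector with first entry `x.den ^ k`. -/
lemma finite_solutions (hk : 2 ≤ k) (h0 : 0 ≤ ζ) (h1 : ζ ≤ 1 / 4) (h3 : 3 ≤ (r 0).den)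
    (hgrow : ∀ n, 4 * (r n).den ^ 2 ≤ (r (n + 1)).den)
    (hr : ∀ n, |ζ - r n| ≤ 2 / ((r (n + 1)).den : ℝ)) (hne : ∀ n, ζ ≠ r n)
    {x₀ : ℕ} (hΨ : ∀ x, x₀ ≤ x → Ψ x < 1 / 2 * (x : ℝ)⁻¹) {N : ℕ}
    (hbad : ∀ n ≥ N, Ψ ((r n).den ^ k) < |ζ - r n| * (((r n).den ^ k : ℕ) : ℝ))
    {S : Set (ℕ × (Fin k → ℤ))} (hS : ∀ v ∈ S, IsSolution k Ψ ζ v)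
    (hred : ∀ v ∈ S, ∀ x : ℚ, x.den ^ k ∣ v.1 →
      (∀ j : Fin k, (v.2 j : ℚ) = x ^ ((j : ℕ) + 1) * v.1) → |ζ - x| * v.1 ≤ Ψ v.1 →
      |ζ - x| * ((x.den ^ k : ℕ) : ℝ) ≤ Ψ (x.den ^ k)) : S.Finite := by
  obtain ⟨M, hM⟩ : ∃ M : ℕ, ∀ n < N, |ζ - r n|⁻¹ ≤ M := by
    obtain ⟨C, hC⟩ := ((Set.finite_Iio N).image fun n ↦ |ζ - r n|⁻¹).bddAbove
    obtain ⟨M, hM⟩ := exists_nat_ge C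
    exact ⟨M, fun n hn ↦ (hC ⟨n, hn, rfl⟩).trans hM⟩
  -- Beyond this bound `Ψ q < 1 / (2 q)` and `q ≥ (r 0).den` hold, and `q > M` excludes the finitely
  -- many `r n` with `n < N`.
  refine finite_of_isSolution_of_le hS (2 + x₀ + (r 0).den + M) fun v hv ↦ ?_
  by_contra! hlt
  obtain ⟨x, hdvd, hpow, hle, hsq⟩ :=
    (hS v hv).exists_rat (by omega) h0 h1 (by omega) (hΨ _ (by omega))
  have hden : x.den ^ 2 ≤ v.1 :=
    (Nat.pow_le_pow_right x.den_pos hk).trans (Nat.le_of_dvd (by omega) hdvd)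
  obtain ⟨n, rfl⟩ := exists_eq_of_abs_sub_lt h3 hgrow hr hden (by omega) hsq
  rcases lt_or_ge n N with hn | hn
  · have hpos : 0 < |ζ - r n| := abs_pos.2 (sub_ne_zero.2 (hne n))
    have hq : (M : ℝ) < v.1 := by exact_mod_cast (by omega : M < v.1)
    have hq1 : (1 : ℝ) ≤ v.1 := by exact_mod_cast (by omega : 1 ≤ v.1)
    have h4 : (v.1 : ℝ)⁻¹ < |ζ - r n| := inv_lt_of_inv_lt₀ hpos ((hM n hn).trans_lt hq)
    have h5 : (v.1 : ℝ)⁻¹ ≤ 1 := inv_le_one_of_one_le₀ hq1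
    have h6 : 0 < (v.1 : ℝ)⁻¹ := by positivity
    nlinarith
  · exact (hbad n hn).not_ge (hred v hv _ hdvd hpow hle)

end Exact

/-! ### Choice of the exponents -/

/-- Exponents following the step function `m`; every second step is shortened by one or not
according to the bits of `σ`. -/
def expSeq (m : ℕ → ℕ) (A : ℕ) (σ : ℕ → Bool) : ℕ → ℕ
  | 0 => A
  | n + 1 => m (expSeq m A σ n) - if n % 2 = 1 ∧ σ (n / 2) = true then 1 else 0

section ExpSeq

variable {m : ℕ → ℕ} {A : ℕ} {σ : ℕ → Bool}

lemma expSeq_succ_even (m : ℕ → ℕ) (A : ℕ) (σ : ℕ → Bool) (n : ℕ) :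
    expSeq m A σ (2 * n + 1) = m (expSeq m A σ (2 * n)) := by
  simp [expSeq]

lemma expSeq_succ_odd (m : ℕ → ℕ) (A : ℕ) (σ : ℕ → Bool) (n : ℕ) :
    expSeq m A σ (2 * n + 1 + 1) =
      m (expSeq m A σ (2 * n + 1)) - if σ n = true then 1 else 0 := by
  have e1 : (2 * n + 1) % 2 = 1 := by omega
  have e2 : (2 * n + 1) / 2 = n := by omega
  rw [expSeq, e1, e2]
  simp only [true_and]

lemma le_expSeq_succ (n : ℕ) : m (expSeq m A σ n) - 1 ≤ expSeq m A σ (n + 1) := by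
  rw [expSeq]; split_ifs <;> omega

lemma expSeq_succ_le (n : ℕ) : expSeq m A σ (n + 1) ≤ m (expSeq m A σ n) := by
  rw [expSeq]; omega

lemma le_expSeq (hm : ∀ a, A ≤ a → 4 * a < m a) (n : ℕ) : A ≤ expSeq m A σ n := by
  induction n with
  | zero => exact le_rfl
  | succ n ih =>
    have := hm _ ih
    have := le_expSeq_succ (m := m) (A := A) (σ := σ) n
    omega

lemma four_mul_expSeq_le (hm : ∀ a, A ≤ a → 4 * a < m a) (n : ℕ) :
    4 * expSeq m A σ n ≤ expSeq m A σ (n + 1) := by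
  have := hm _ (le_expSeq (σ := σ) hm n)
  have := le_expSeq_succ (m := m) (A := A) (σ := σ) n
  omega

lemma expSeq_strictMono (hA : 0 < A) (hm : ∀ a, A ≤ a → 4 * a < m a) :
    StrictMono (expSeq m A σ) := strictMono_nat_of_lt_succ fun n ↦ by
  have := le_expSeq (σ := σ) hm n
  have := four_mul_expSeq_le (σ := σ) hm n
  omega

lemma expSeq_injective (hm : ∀ a, A ≤ a → 4 * a < m a) : Function.Injective (expSeq m A) := by
  intro σ τ h
  funext i
  have h1 := congrFun h (2 * i + 1 + 1)
  rw [expSeq_succ_odd, expSeq_succ_odd, h] at h1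
  have h2 := hm _ (le_expSeq (σ := τ) hm (2 * i + 1))
  generalize expSeq m A τ (2 * i + 1) = x at h1 h2
  cases hs : σ i <;> cases ht : τ i <;> simp only [hs, ht, if_true] at h1 ⊢ <;>
    simp at h1 <;> omega

end ExpSeq

/-- Take the least `m` satisfying the first inequality. `F` stands for `Ψ q / q`, and `β ^ m + 2 * β
^ (2 * m)` bounds a tail that starts with exponent `m` and at least doubles next. -/
lemma exists_step {β F : ℝ} (h0 : 0 < β) (h1 : β ≤ 1 / 2) (hF : 0 < F) {a : ℕ}
    (hFa : F < β ^ (4 * a)) :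
    ∃ m, 4 * a < m ∧ β ^ m + 2 * β ^ (2 * m) ≤ F ∧ F < β ^ (m - 1) + 2 * β ^ (2 * (m - 1)) := by
  have hex : ∃ m : ℕ, β ^ m + 2 * β ^ (2 * m) ≤ F := by
    obtain ⟨m, hm⟩ := exists_pow_lt_of_lt_one (show 0 < F / 3 by positivity)
      (show β < 1 by linarith)
    refine ⟨m, ?_⟩
    have : β ^ (2 * m) ≤ β ^ m := pow_le_pow_of_le_one h0.le (by linarith) (by omega)
    linarith
  classical
  have hspec := Nat.find_spec hex
  have hmin := fun j ↦ Nat.find_min (m := j) hex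
  generalize Nat.find hex = m at hspec hmin
  have hpos : 0 < β ^ (2 * m) := by positivity
  have hm : 4 * a < m := (pow_lt_pow_iff_right_of_lt_one₀ h0 (by linarith)).1
    (show β ^ m < β ^ (4 * a) by linarith)
  exact ⟨m, hm, hspec, not_le.1 (hmin _ (by omega))⟩

/-! ### Partial sums as reduced fractions -/

section PartialSum

variable {b : ℕ} {a : ℕ → ℕ}

/-- The partial sum of `∑ b ^ (-a n)` up to the index `n`, as a rational number. -/
def partialSum (b : ℕ) (a : ℕ → ℕ) (n : ℕ) : ℚ := (partialNum b a n : ℚ) / (b : ℚ) ^ a n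

lemma den_partialSum (hb : 0 < b) (ha : StrictMono a) (n : ℕ) :
    (partialSum b a n).den = b ^ a n := by
  have h := Rat.den_div_eq_of_coprime (a := partialNum b a n) (b := ((b ^ a n : ℕ) : ℤ))
    (by exact_mod_cast pow_pos hb _) (by simpa using (partialNum_coprime ha n).pow_right _)
  have h' : (partialSum b a n).den = ((b ^ a n : ℕ) : ℤ) := by
    rw [← h, partialSum]; push_cast; rfl
  exact_mod_cast h'

lemma partialSum_cast (hb : 0 < b) (ha : StrictMono a) (n : ℕ) :
    (partialSum b a n : ℝ) = ∑ i ∈ Finset.range (n + 1), ((b : ℝ)⁻¹) ^ a i := by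
  rw [← partialNum_div hb ha, partialSum]; push_cast; rfl

lemma inv_le_half (hb : 2 ≤ b) : (b : ℝ)⁻¹ ≤ 1 / 2 := by
  rw [one_div]
  have : (2 : ℝ) ≤ b := by exact_mod_cast hb
  gcongr

lemma tsum_sub_partialSum (hb : 2 ≤ b) (ha : StrictMono a) (n : ℕ) :
    ∑' i, ((b : ℝ)⁻¹) ^ a i - partialSum b a n = ∑' i, ((b : ℝ)⁻¹) ^ a (i + (n + 1)) := by
  have hb0 : 0 < b := by omega
  rw [partialSum_cast hb0 ha, sub_eq_iff_eq_add',
    (summable_pow_strictMono (by positivity) (inv_le_half hb) ha).sum_add_tsum_nat_add]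

end PartialSum

/-! ### Exact order of approximation and uncountability -/

/-- The numbers `∑ b ^ (-a n)` for the exponents `expSeq m A σ`, when `m` is the step function
attached to `Ψ`, have exactly the order of approximation `Ψ` up to the factor `b`. -/
lemma tsum_expSeq_mem {k b : ℕ} (hk : 2 ≤ k) (hb : 2 ≤ b) {Ψ : ℕ → ℝ} {x₀ : ℕ}
    (hΨ : ∀ x : ℕ, x₀ ≤ x → Ψ x < 1 / 2 * (x : ℝ)⁻¹) {m : ℕ → ℕ} {A : ℕ} (hA : 3 ≤ A)
    (hm : ∀ a, A ≤ a → 4 * a < m a ∧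
      ((b : ℝ)⁻¹) ^ m a + 2 * ((b : ℝ)⁻¹) ^ (2 * m a) ≤
        Ψ ((b ^ a) ^ k) * ((((b ^ a) ^ k : ℕ) : ℝ))⁻¹ ∧
      Ψ ((b ^ a) ^ k) * ((((b ^ a) ^ k : ℕ) : ℝ))⁻¹ <
        ((b : ℝ)⁻¹) ^ (m a - 1) + 2 * ((b : ℝ)⁻¹) ^ (2 * (m a - 1)))
    (σ : ℕ → Bool) {ζ : ℝ} (hζ : ζ = ∑' n, ((b : ℝ)⁻¹) ^ expSeq m A σ n) :
    {v : ℕ × (Fin k → ℤ) | IsSolution k Ψ ζ v ∧ IsPrimitive v}.Infinite ∧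
    ∀ c : ℝ, 0 < c → c ≤ 1 → c < (b : ℝ)⁻¹ →
      {v : ℕ × (Fin k → ℤ) | IsSolution k (fun q ↦ c * Ψ q) ζ v ∧ IsPrimitive v}.Finite ∧
      ((∀ l x : ℕ, 1 ≤ l → 1 ≤ x → Ψ (l * x) ≤ (l : ℝ) * Ψ x) →
        {v : ℕ × (Fin k → ℤ) | IsSolution k (fun q ↦ c * Ψ q) ζ v}.Finite) := by
  have hm1 : ∀ a, A ≤ a → 4 * a < m a := fun a ha ↦ (hm a ha).1
  have hb0 : 0 < b := by omega
  have hbr : (0 : ℝ) < b := by exact_mod_cast hb0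
  have hmono : StrictMono (expSeq m A σ) := expSeq_strictMono (by omega) hm1
  have hfour : ∀ n, 4 * expSeq m A σ n ≤ expSeq m A σ (n + 1) := four_mul_expSeq_le hm1
  have hAle : ∀ n, A ≤ expSeq m A σ n := le_expSeq hm1
  have hle : ∀ n, expSeq m A σ (n + 1) ≤ m (expSeq m A σ n) := expSeq_succ_le
  have heven : ∀ n, expSeq m A σ (2 * n + 1) = m (expSeq m A σ (2 * n)) := expSeq_succ_even m A σ
  set a := expSeq m A σ with ha
  set β : ℝ := (b : ℝ)⁻¹ with hβ
  have hβ0 : 0 < β := by positivity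
  have hβ1 : β ≤ 1 / 2 := inv_le_half hb
  set r := partialSum b a with hr
  have hden : ∀ n, (r n).den = b ^ a n := den_partialSum hb0 hmono
  have hsub : ∀ n, ζ - r n = ∑' i, β ^ a (i + (n + 1)) := fun n ↦ by
    rw [hζ]; exact tsum_sub_partialSum hb hmono n
  have hpos : ∀ n, 0 < ζ - r n := fun n ↦ by
    rw [hsub]; exact tsum_pow_pos hβ0 hβ1 hmono _
  have hr0 : ∀ n, 0 ≤ (r n : ℝ) := fun n ↦ by
    rw [hr, partialSum_cast hb0 hmono]
    positivity
  have h0 : 0 ≤ ζ := by linarith [hpos 0, hr0 0]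
  have h1 : ζ ≤ 1 / 4 := by
    have h := tsum_pow_le hβ0 hβ1 hmono 0
    have h2 : β ^ a 0 ≤ (1 / 2) ^ 3 :=
      calc β ^ a 0 ≤ β ^ 3 := pow_le_pow_of_le_one hβ0.le (by linarith) hA
        _ ≤ _ := by gcongr
    simp only [add_zero] at h
    rw [hζ]
    linarith
  have hgrow : ∀ n, 4 * (r n).den ^ 2 ≤ (r (n + 1)).den := fun n ↦ by
    have h2 := hfour n
    have h3 := hAle n
    rw [hden, hden]
    calc 4 * (b ^ a n) ^ 2 ≤ b ^ 2 * (b ^ a n) ^ 2 := by gcongr; nlinarith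
      _ = b ^ (2 + a n * 2) := by rw [pow_add, pow_mul]
      _ ≤ b ^ a (n + 1) := Nat.pow_le_pow_right hb0 (by omega)
  have h3 : 3 ≤ (r 0).den := by
    rw [hden]
    calc 3 ≤ 2 ^ 3 := by norm_num
      _ ≤ b ^ 3 := by gcongr
      _ ≤ b ^ a 0 := Nat.pow_le_pow_right hb0 hA
  have herr : ∀ n, |ζ - r n| ≤ 2 / ((r (n + 1)).den : ℝ) := fun n ↦ by
    rw [abs_of_pos (hpos n), hsub, hden]
    refine (tsum_pow_le hβ0 hβ1 hmono (n + 1)).trans_eq ?_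
    rw [hβ, inv_pow]; push_cast; rfl
  have hdenmono : StrictMono fun n ↦ (r n).den := fun i j hij ↦ by
    simp only [hden]
    exact Nat.pow_lt_pow_right (by omega) (hmono hij)
  have hDpos : ∀ n, (0 : ℝ) < (((b ^ a n) ^ k : ℕ) : ℝ) := fun n ↦ by
    exact_mod_cast pow_pos (pow_pos hb0 _) _
  -- Indices `2 * N` are used because the step after an even index is never shortened.
  refine ⟨infinite_primitive_solutions (r := r) (by omega) h0 h1 hr0
    (fun n ↦ by linarith [hpos n]) hdenmono fun N ↦ ⟨2 * N, by omega, ?_⟩,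
    fun c hc0 hc1 hcb ↦ ?_⟩
  · have h4 := (hm _ (hAle (2 * N))).2.1
    rw [← heven] at h4
    rw [hden, ← le_mul_inv_iff₀ (hDpos _), abs_of_pos (hpos _), hsub,
      tsum_pow_eq_add hβ0 hβ1 hmono]
    refine le_trans ?_ h4
    have h5 := tsum_pow_le hβ0 hβ1 hmono (2 * N + 1 + 1)
    have h6 : β ^ a (2 * N + 1 + 1) ≤ β ^ (2 * a (2 * N + 1)) := by
      have := hfour (2 * N + 1)
      exact pow_le_pow_of_le_one hβ0.le (by linarith) (by omega)
    linarith
  -- This `N` makes `c * (1 + 2 * β ^ N) < β`; such room exists exactly because `c < β`.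
  · obtain ⟨N, hN⟩ : ∃ N : ℕ, β ^ N < (β / c - 1) / 2 :=
      exists_pow_lt_of_lt_one (half_pos (sub_pos.2 ((one_lt_div hc0).2 hcb))) (by linarith)
    -- With `t = β ^ (m (a n) - 1)`, minimality bounds the left side, divided by the denominator, by
    -- `c * t * (1 + 2 * t) ≤ β * t = β ^ m (a n)`, which is below the error.
    have hbad : ∀ n ≥ N, c * Ψ ((r n).den ^ k) < |ζ - r n| * (((r n).den ^ k : ℕ) : ℝ) := by
      intro n hn
      have h4 := hm _ (hAle n)
      rw [hden, ← mul_inv_lt_iff₀ (hDpos _), abs_of_pos (hpos _), hsub,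
        tsum_pow_eq_add hβ0 hβ1 hmono, mul_assoc]
      have h5 := tsum_pow_pos hβ0 hβ1 hmono (n + 1 + 1)
      have h6 : β ^ m (a n) ≤ β ^ a (n + 1) :=
        pow_le_pow_of_le_one hβ0.le (by linarith) (hle n)
      have h7 : β ^ m (a n) = β * β ^ (m (a n) - 1) := by
        rw [← pow_succ', Nat.sub_add_cancel (by omega)]
      have h8 : β ^ (m (a n) - 1) ≤ β ^ N := by
        have := hmono.id_le n
        simp only [id] at this
        exact pow_le_pow_of_le_one hβ0.le (by linarith) (by omega)
      have h9 : 0 < β ^ (m (a n) - 1) := by positivity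
      have h10 : β ^ (2 * (m (a n) - 1)) = (β ^ (m (a n) - 1)) ^ 2 := by rw [mul_comm, pow_mul]
      have h11 := mul_lt_mul_of_pos_left h4.2.2 hc0
      rw [h10] at h11
      have h12 : c * (1 + 2 * β ^ (m (a n) - 1)) ≤ β := by
        rw [← le_div_iff₀' hc0]; linarith
      nlinarith
    have hΨc : ∀ x, x₀ ≤ x → c * Ψ x < 1 / 2 * (x : ℝ)⁻¹ := fun x hx ↦ by
      have h4 := hΨ x hx
      have h5 : 0 ≤ 1 / 2 * (x : ℝ)⁻¹ := by positivity
      nlinarith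
    have hne : ∀ n, ζ ≠ r n := fun n ↦ (sub_pos.1 (hpos n)).ne'
    refine ⟨finite_solutions hk h0 h1 h3 hgrow herr hne hΨc hbad (fun v hv ↦ hv.1) ?_,
      fun hsubm ↦ finite_solutions hk h0 h1 h3 hgrow herr hne hΨc hbad (fun v hv ↦ hv) ?_⟩
    · intro v hv x hd hx hle
      rwa [hv.2.fst_eq hd hx] at hle
    · intro v hv x hd hx hle
      obtain ⟨l, hl⟩ := hd
      have hD : 1 ≤ x.den ^ k := Nat.one_le_pow _ _ x.den_pos
      have hl1 : 1 ≤ l := Nat.pos_of_ne_zero fun h ↦ by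
        have := hv.1
        simp [hl, h] at this
      have hl0 : (0 : ℝ) < l := by exact_mod_cast hl1
      have h4 := hsubm l (x.den ^ k) hl1 hD
      rw [hl] at hle
      rw [mul_comm l] at h4
      refine le_of_mul_le_mul_left ?_ hl0
      push_cast at hle h4 ⊢
      nlinarith

lemma not_countable_of_forall_bool {f : (ℕ → Bool) → ℝ} (hf : Function.Injective f) {S : Set ℝ}
    (hS : ∀ σ, Transcendental ℚ (f σ) → f σ ∈ S) : ¬ S.Countable := fun h ↦ by
  have h1 : (Set.range f).Countable := by
    refine (h.union (Algebraic.countable ℚ ℝ)).mono ?_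
    rintro _ ⟨σ, rfl⟩
    by_cases hσ : IsAlgebraic ℚ (f σ)
    · exact Or.inr hσ
    · exact Or.inl (hS σ hσ)
  have := h1.to_subtype
  have : Countable (ℕ → Bool) := (Equiv.ofInjective f hf).injective.countable
  obtain ⟨g, hg⟩ := exists_surjective_nat (ℕ → Bool)
  obtain ⟨n, hn⟩ := hg fun i ↦ !g i i
  simpa using congrFun hn n

end PowerApprox

theorem theorem8 (k b : ℕ) (hk : 2 ≤ k) (hb : 2 ≤ b) (Ψ : ℕ → ℝ)
    (hpos : ∀ q : ℕ, 1 ≤ q → 0 < Ψ q)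
    (hA : ∃ x₀ : ℕ, ∀ x : ℕ, x₀ ≤ x → Ψ x < 1 / 2 * (x : ℝ)⁻¹) :
    ((∀ l x : ℕ, 1 ≤ l → 1 ≤ x → Ψ (l * x) ≤ (l : ℝ) * Ψ x) →
      ∀ c : ℝ, c < 1 / (b : ℝ) →
        ¬ ((PowerApprox.approxSet k Ψ \ PowerApprox.approxSet k (fun q => c * Ψ q)) ∩
            PowerApprox.digitSet b {0, 1}).Countable) ∧
    (∀ c : ℝ, c < 1 / (b : ℝ) →
      ¬ ((PowerApprox.approxSetStar k Ψ \ PowerApprox.approxSetStar k (fun q => c * Ψ q)) ∩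
          PowerApprox.digitSet b {0, 1}).Countable) := by
  obtain ⟨x₀, hx₀⟩ := hA
  have hb0 : 0 < b := by omega
  have hbr : (0 : ℝ) < b := by exact_mod_cast hb0
  have hβ0 : 0 < (b : ℝ)⁻¹ := by positivity
  have hβ1 : (b : ℝ)⁻¹ ≤ 1 / 2 := PowerApprox.inv_le_half hb
  -- The condition on `a` stands under the existential so that `choose` gives a total function; its
  -- value `0` at small `a` is never relevant.
  have hstep : ∀ a, ∃ m, x₀ + 3 ≤ a → 4 * a < m ∧
      ((b : ℝ)⁻¹) ^ m + 2 * ((b : ℝ)⁻¹) ^ (2 * m) ≤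
        Ψ ((b ^ a) ^ k) * ((((b ^ a) ^ k : ℕ) : ℝ))⁻¹ ∧
      Ψ ((b ^ a) ^ k) * ((((b ^ a) ^ k : ℕ) : ℝ))⁻¹ <
        ((b : ℝ)⁻¹) ^ (m - 1) + 2 * ((b : ℝ)⁻¹) ^ (2 * (m - 1)) := fun a ↦ by
    by_cases ha : x₀ + 3 ≤ a
    · have hpa : 0 < b ^ a := pow_pos hb0 a
      have hD : (b ^ a) ^ 2 ≤ (b ^ a) ^ k := Nat.pow_le_pow_right hpa hk
      have hx : x₀ ≤ (b ^ a) ^ k :=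
        calc x₀ ≤ a := by omega
          _ ≤ b ^ a := (Nat.lt_pow_self (by omega)).le
          _ ≤ (b ^ a) ^ k := Nat.le_self_pow (by omega) _
      have hD0 : 0 < (b ^ a) ^ k := pow_pos hpa k
      have hΨ := hx₀ _ hx
      have hΨ0 := hpos _ hD0
      generalize (b ^ a) ^ k = D at hD hD0 hΨ hΨ0
      have hDr : (0 : ℝ) < D := by exact_mod_cast hD0
      have hDinv : (D : ℝ)⁻¹ ≤ ((b : ℝ)⁻¹) ^ (2 * a) := by
        rw [inv_pow, mul_comm, pow_mul]
        have : ((b : ℝ) ^ a) ^ 2 ≤ D := by exact_mod_cast hD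
        gcongr
      have hDinv0 : 0 < (D : ℝ)⁻¹ := by positivity
      obtain ⟨m, hm⟩ := PowerApprox.exists_step (a := a) hβ0 hβ1 (mul_pos hΨ0 hDinv0) <| by
        calc Ψ D * (D : ℝ)⁻¹ < 1 / 2 * (D : ℝ)⁻¹ * (D : ℝ)⁻¹ := by gcongr
          _ ≤ (D : ℝ)⁻¹ * (D : ℝ)⁻¹ := by nlinarith
          _ ≤ ((b : ℝ)⁻¹) ^ (2 * a) * ((b : ℝ)⁻¹) ^ (2 * a) := by gcongr
          _ = _ := by rw [← pow_add]; congr 1; omega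
      exact ⟨m, fun _ ↦ hm⟩
    · exact ⟨0, fun h ↦ absurd h ha⟩
  choose m hm using hstep
  have hm1 : ∀ a, x₀ + 3 ≤ a → 4 * a < m a := fun a ha ↦ (hm a ha).1
  have hmono : ∀ σ, StrictMono (PowerApprox.expSeq m (x₀ + 3) σ) :=
    fun σ ↦ PowerApprox.expSeq_strictMono (by omega) hm1
  have hinj : Function.Injective fun σ ↦
      ∑' n, ((b : ℝ)⁻¹) ^ PowerApprox.expSeq m (x₀ + 3) σ n := fun σ τ h ↦
    PowerApprox.expSeq_injective hm1
      (PowerApprox.eq_of_tsum_pow_eq hβ0 hβ1 (hmono σ) (hmono τ) h)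
  have hdig := fun σ ↦ PowerApprox.tsum_pow_mem_digitSet hb (hmono σ) (Nat.succ_pos _)
  have hmem := fun σ ↦ PowerApprox.tsum_expSeq_mem hk hb hx₀ (by omega) hm σ rfl
  -- Since `c` may be nonpositive, it is raised to a positive value still below `1 / b`; as `Ψ > 0`
  -- on `q ≥ 1`, no solutions are lost.
  have hc' : ∀ c : ℝ, c < 1 / (b : ℝ) → 0 < max c ((b : ℝ)⁻¹ / 2) ∧
      max c ((b : ℝ)⁻¹ / 2) ≤ 1 ∧ max c ((b : ℝ)⁻¹ / 2) < (b : ℝ)⁻¹ := fun c hc ↦ by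
    rw [one_div] at hc
    have h : max c ((b : ℝ)⁻¹ / 2) < (b : ℝ)⁻¹ := max_lt hc (half_lt_self hβ0)
    exact ⟨lt_max_of_lt_right (half_pos hβ0), by linarith, h⟩
  have hle : ∀ (c ζ : ℝ) (v : ℕ × (Fin k → ℤ)), PowerApprox.IsSolution k (fun q ↦ c * Ψ q) ζ v →
      PowerApprox.IsSolution k (fun q ↦ max c ((b : ℝ)⁻¹ / 2) * Ψ q) ζ v := fun c ζ v hv ↦
    ⟨hv.1, fun j ↦ (hv.2 j).trans
      (mul_le_mul_of_nonneg_right (le_max_left _ _) (hpos _ hv.1).le)⟩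
  refine ⟨fun hsub c hc ↦ ?_, fun c hc ↦ ?_⟩ <;>
    refine PowerApprox.not_countable_of_forall_bool hinj fun σ hσ ↦
      ⟨⟨⟨fun h ↦ hσ h.1, ?_⟩, ?_⟩, hdig σ⟩
  · exact (hmem σ).1.mono fun v hv ↦ hv.1
  · obtain ⟨h1, h2, h3⟩ := hc' c hc
    exact fun h ↦ h.2 ((((hmem σ).2 _ h1 h2 h3).2 hsub).subset fun v hv ↦ hle _ _ _ hv)
  · exact (hmem σ).1
  · obtain ⟨h1, h2, h3⟩ := hc' c hc
    exact fun h ↦ h.2 (((hmem σ).2 _ h1 h2 h3).1.subset fun v hv ↦ ⟨hle _ _ _ hv.1, hv.2⟩)
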